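/- \textbf{Theorem 1} (lower bound for temperature 1 in just-barely 3D). Work in the three-dimensional abstract Tile Assembly Model over a fixed alphabet $\Sigma$. A glue is a pair $(\text{label},\text{strength})\in\Sigma^*\times\mathbb{N}$, and a tile type is a unit cube with a glue on each of its six sides. A configuration over a finite tile set $T$ is a partial function $\alpha:\mathbb{Z}^3\dashrightarrow T$. Its binding graph has vertex set $\operatorname{dom}\alpha$ and an edge between two adjacent positions whenever their abutting glues are equal (in label and strength) and of positive strength; the weight of the edge is that strength. An assembly is a configuration whose domain is non-empty and connected in the unit-distance grid graph; it is $\tau$-stable if every set of edges of the binding graph whose removal disconnects that graph has total weight at least $\tau$. A tile assembly system (TAS) $\mathcal{T}=(T,\sigma,\tau)$ consists of a finite tile set $T$, a $\tau$-stable seed assembly $\sigma$ with $|\operatorname{dom}\sigma|=1$, and a temperature $\tau\in\mathbb{Z}^+$. A one-step extension of a $\tau$-stable assembly is a $\tau$-stable assembly that extends it by exactly one tile. An assembly is producible if it is the result (union) of a finite or infinite sequence of one-step extensions that starts at $\sigma$, and terminal if it is $\tau$-stable and has no one-step extension. $\mathcal{T}$ uniquely self-assembles a set $X\subseteq\mathbb{Z}^3$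 if it has exactly one producible terminal assembly $\alpha$ (i.e. it is directed) and $\operatorname{dom}\alpha=X$. The directed tile complexity $K^{\tau}_{USA}(X)$ is the minimum of $|T|$ over all TASs $(T,\sigma,\tau)$ of temperature $\tau$ that uniquely self-assemble $X$ (with the convention $\min\emptyset=\infty$). Let $k,N\in\mathbb{Z}^+$, and let $R^3_{k,N}$ be any set with $$\{0,\dots,N-1\}\times\{0,\dots,k-1\}\times\{0\}\subseteq R^3_{k,N}\subseteq\{0,\dots,N-1\}\times\{0,\dots,k-1\}\times\{0,1\}.$$ If $\mathcal{T}=(T,\sigma,1)$ is a TAS of temperature $1$ that uniquely self-assembles $R^3_{k,N}$, and $G$ is the set of all glues on the tile types in $T$, then $$N\le 3\cdot|G|^k\cdot k\cdot 16^k\qquad\text{and}\qquad |T|\ge \frac{N^{1/k}}{576}.$$ Consequently $K^{1}_{USA}\left(R^3_{k,N}\right)\ge N^{1/k}/576$ for all $k,N\in\mathbb{Z}^+$; that is, $K^{1}_{USA}\left(R^3_{k,N}\right)=\Omega\left(N^{1/k}\right)$, with a constant that depends on neither $k$ nor $N$. -/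

import Mathlib

open scoped ENNReal

namespace ATAM

/-- Points of the three-dimensional integer lattice, written `(x, y, z)`. -/
abbrev Pos : Type := ℤ × ℤ × ℤ

/-- The six sides of a unit cube. -/
inductive Side : Type
  | east | west | north | south | up | down
  deriving DecidableEq

namespace Side

instance : Fintype Side where
  elems := {east, west, north, south, up, down}
  complete := by intro d; cases d <;> decide

/-- The unit vector pointing from the centre of a cube to the given side. -/
def vec : Side → Pos
  | east => (1, 0, 0)
  | west => (-1, 0, 0)
  | north => (0, 1, 0)
  | south => (0, -1, 0)
  | up => (0, 0, 1)
  | down => (0, 0, -1)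

/-- The opposite side of a cube. -/
def opp : Side → Side
  | east => west
  | west => east
  | north => south
  | south => north
  | up => down
  | down => up

theorem opp_opp (d : Side) : d.opp.opp = d := by cases d <;> rfl

theorem vec_opp (d : Side) : d.opp.vec = -d.vec := by cases d <;> rfl

theorem vec_ne_zero (d : Side) : d.vec ≠ 0 := by cases d <;> decide

/-- Passing to the opposite side, as a permutation of the six sides. -/
def oppEquiv : Side ≃ Side := ⟨opp, opp, opp_opp, opp_opp⟩

end Side

/-- A glue: a finite string over the alphabet `A` (the label) and a strength. -/
abbrev Glue (A : Type*) : Type _ := List A × ℕ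

/-- A tile type: a unit cube with a glue on each of its six sides. -/
abbrev TileType (A : Type*) : Type _ := Side → Glue A

variable {A : Type*}

open Classical in
/-- The set of all glues that occur on the tile types of a tile set. -/
noncomputable def glues (T : Finset (TileType A)) : Finset (Glue A) :=
  T.biUnion fun t => Finset.univ.image t

/-- A configuration: a partial function from the lattice to the tile set `T`. -/
abbrev Config (T : Finset (TileType A)) : Type _ := Pos → Option T

variable {T : Finset (TileType A)}

/-- The set of occupied positions. -/
def dom (α : Config T) : Set Pos := {p | ∃ t, α p = some t}

/-- `SubConfig α β` (written `α ⊑ β` on paper): `β` extends `α`. -/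
def SubConfig (α β : Config T) : Prop :=
  dom α ⊆ dom β ∧ ∀ p ∈ dom α, α p = β p

/-- The full grid graph of a set of positions: adjacency means unit distance. -/
def fullGridGraph (V : Set Pos) : SimpleGraph V where
  Adj p q := ∃ d : Side, (q : Pos) = (p : Pos) + d.vec
  symm := ⟨by
    rintro p q ⟨d, h⟩
    exact ⟨d.opp, by rw [h, Side.vec_opp]; abel⟩⟩
  loopless := ⟨by
    rintro p ⟨d, h⟩
    exact d.vec_ne_zero (left_eq_add.mp h)⟩

open Classical in
/-- The strength of the bond between the tile `s` and the tile `t` that abuts it on side `d`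
of `s`: the common strength if the two abutting glues are equal, and `0` otherwise. -/
noncomputable def abutStrength (s t : TileType A) (d : Side) : ℕ :=
  if s d = t d.opp then (s d).2 else 0

theorem abutStrength_symm (s t : TileType A) (d : Side) :
    abutStrength t s d.opp = abutStrength s t d := by
  unfold abutStrength
  rw [Side.opp_opp]
  by_cases h : s d = t d.opp
  · rw [if_pos h, if_pos h.symm, h]
  · rw [if_neg h, if_neg (fun h' => h h'.symm)]

/-- The strength of the bond between the tiles that `α` places at `p` and at `q`; it is `0` unless
`p` and `q` are adjacent and both occupied (at most one side `d` contributes to the sum). -/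
noncomputable def bondStrength (α : Config T) (p q : Pos) : ℕ :=
  ∑ d : Side, if q = p + d.vec then
    (match α p, α q with
      | some s, some t => abutStrength s.1 t.1 d
      | _, _ => 0)
  else 0

theorem bondStrength_symm (α : Config T) (p q : Pos) :
    bondStrength α p q = bondStrength α q p := by
  unfold bondStrength
  rw [← Equiv.sum_comp Side.oppEquiv]
  refine Finset.sum_congr rfl fun d _ => ?_
  change (if q = p + d.opp.vec then _ else 0) = _
  have hpq : (q = p + d.opp.vec) ↔ (p = q + d.vec) := by
    rw [Side.vec_opp, ← sub_eq_add_neg, eq_sub_iff_add_eq, eq_comm]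
  by_cases h : p = q + d.vec
  · rw [if_pos (hpq.mpr h), if_pos h]
    change (match α p, α q with
      | some s, some t => abutStrength s.1 t.1 d.opp
      | _, _ => 0) = _
    rcases α p with _ | s <;> rcases α q with _ | t <;> simp only
    exact abutStrength_symm _ _ _
  · rw [if_neg (fun h' => h (hpq.mp h')), if_neg h]

theorem bondStrength_self (α : Config T) (p : Pos) : bondStrength α p p = 0 := by
  unfold bondStrength
  refine Finset.sum_eq_zero fun d _ => if_neg fun h => d.vec_ne_zero (left_eq_add.mp h)

/-- The binding graph: the occupied positions, with an edge between two positions whose tiles bind,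
that is, whose abutting glues are equal and of positive strength. -/
def bindingGraph (α : Config T) : SimpleGraph (dom α) where
  Adj p q := 0 < bondStrength α p q
  symm := ⟨fun p q h => by rwa [bondStrength_symm]⟩
  loopless := ⟨fun p h => by rw [bondStrength_self] at h; exact lt_irrefl _ h⟩

/-- The weight of an edge of the binding graph: the strength of the glue it represents. -/
noncomputable def edgeStrength (α : Config T) : Sym2 (dom α) → ℕ :=
  Sym2.lift ⟨fun p q => bondStrength α p q, fun p q => bondStrength_symm α p q⟩

/-- An assembly: a non-empty configuration whose full grid graph is connected. -/
def IsAssembly (α : Config T) : Prop := (fullGridGraph (dom α)).Connected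

/-- A cut-set: a set of edges whose removal leaves two or more disconnected parts. -/
def IsCutSet {V : Type*} (G : SimpleGraph V) (S : Set (Sym2 V)) : Prop :=
  S ⊆ G.edgeSet ∧ ¬ (G.deleteEdges S).Preconnected

/-- `τ`-stable assemblies: each cut-set of the binding graph has total weight at least `τ`. -/
def IsStable (τ : ℕ) (α : Config T) : Prop :=
  IsAssembly α ∧ ∀ S : Set (Sym2 (dom α)), IsCutSet (bindingGraph α) S →
    (τ : ℝ≥0∞) ≤ ∑' e : S, (edgeStrength α e : ℝ≥0∞)

/-- A three-dimensional tile assembly system over the alphabet `A`: a finite tile set,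
a temperature, and a stable seed assembly that consists of a single tile. -/
structure TAS (A : Type*) where
  tiles : Finset (TileType A)
  temp : ℕ
  temp_pos : 0 < temp
  seed : Config tiles
  seed_card : (dom seed).ncard = 1
  seed_stable : IsStable temp seed

namespace TAS

variable (𝒯 : TAS A)

/-- `α` produces `β` in one step. -/
def Step (α β : Config 𝒯.tiles) : Prop :=
  IsStable 𝒯.temp α ∧ IsStable 𝒯.temp β ∧ SubConfig α β ∧ (dom β \ dom α).ncard = 1

/-- `a 0, a 1, …` (all `a i` with `i < k`) is an assembly sequence of length `k`, finite or
infinite. -/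
def IsAssemblySequence (k : ℕ∞) (a : ℕ → Config 𝒯.tiles) : Prop :=
  (∀ i : ℕ, (i : ℕ∞) < k → IsAssembly (a i)) ∧
    ∀ i : ℕ, ((i + 1 : ℕ) : ℕ∞) < k → 𝒯.Step (a i) (a (i + 1))

/-- `α` produces `β` in zero or more, possibly infinitely many, steps. -/
def Produces (α β : Config 𝒯.tiles) : Prop :=
  ∃ k : ℕ∞, k = (dom β \ dom α).encard + 1 ∧
    ∃ a : ℕ → Config 𝒯.tiles, 𝒯.IsAssemblySequence k a ∧ a 0 = α ∧
      dom β = (⋃ i : ℕ, ⋃ _ : (i : ℕ∞) < k, dom (a i)) ∧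
      ∀ i : ℕ, (i : ℕ∞) < k → SubConfig (a i) β

/-- The producible assemblies. -/
def producible : Set (Config 𝒯.tiles) := {α | 𝒯.Produces 𝒯.seed α}

/-- The frontier: the empty positions at which a tile can stably attach to `α`. -/
def frontier (α : Config 𝒯.tiles) : Set Pos :=
  {p | ∃ β, 𝒯.Step α β ∧ p ∈ dom β \ dom α}

/-- Terminal assemblies: stable ones with an empty frontier. -/
def IsTerminal (α : Config 𝒯.tiles) : Prop := IsStable 𝒯.temp α ∧ 𝒯.frontier α = ∅

/-- The producible terminal assemblies. -/
def terminalAssemblies : Set (Config 𝒯.tiles) := {α | α ∈ 𝒯.producible ∧ 𝒯.IsTerminal α}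

/-- `𝒯` uniquely self-assembles the shape `X`: there is exactly one producible terminal assembly
(so `𝒯` is directed), and it occupies exactly the points of `X`. -/
def UniquelySelfAssembles (X : Set Pos) : Prop :=
  ∃ α, 𝒯.terminalAssemblies = {α} ∧ dom α = X

end TAS

/-- The directed tile complexity of the shape `X` at temperature `τ`, over the alphabet `A`: the
least number of tile types of a system that uniquely self-assembles `X` (`⊤` if there is none). -/
noncomputable def directedTileComplexity (A : Type*) (τ : ℕ) (X : Set Pos) : ℕ∞ :=
  sInf {n : ℕ∞ | ∃ 𝒯 : TAS A, 𝒯.temp = τ ∧ 𝒯.UniquelySelfAssembles X ∧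
    n = (𝒯.tiles.card : ℕ∞)}

/-- `X` is a (just-barely) three-dimensional `k × N` rectangle. -/
def IsRectangle (k N : ℕ) (X : Set Pos) : Prop :=
  Set.Ico (0 : ℤ) N ×ˢ Set.Ico (0 : ℤ) k ×ˢ ({0} : Set ℤ) ⊆ X ∧
    X ⊆ Set.Ico (0 : ℤ) N ×ˢ Set.Ico (0 : ℤ) k ×ˢ ({0, 1} : Set ℤ)

end ATAM

/-! At temperature 1 a single bond suffices to attach a tile, so a simple path of bonds starting at
the seed can be grown alone. In a directed system whatever grows from the seed is part of the unique
terminal assembly `α`, because growth can be continued fairly to a terminal assembly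
(`TAS.exists_terminal_extension`).

Take a simple bond path `f` of `α` from the seed to an extreme column. For each window between two
consecutive columns on the way, record the cells crossed outwards, those crossed inwards, and the
glues of the outward crossings. If windows `c₁ < c₂` have equal records, splice: follow `f` up to
`c₂`, and beyond it the part of `f` beyond `c₁`, translated by `c₂ - c₁`; switch at every crossing.
Outward switches bind since the glues agree. Inward switches need no glue data: the translated tile
sits on a position of `f`, so directedness makes it the tile of `f`. The walk has unique
predecessors and its start has none, so it never repeats a state; among finitely many states it must
end, which happens only at the translated endpoint, beyond the extreme column. This is the
contradiction of `TAS.not_similar_windows`.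

Outward and inward crossings use distinct cells among `2k` and alternate, so at most `k` are
outward. Hence at most `16 ^ k * |G| ^ k` records exist, bounding the distance from the seed to
either end. -/

namespace ATAM

variable {A : Type*} {T : Finset (TileType A)}

/-! ### Bonds and stability at temperature 1 -/

/-- The positions `p` and `q` are adjacent, and the tiles of `α` there bind. -/
def Bond (α : Config T) (p q : Pos) : Prop :=
  ∃ (d : Side) (s t : T), q = p + d.vec ∧ α p = some s ∧ α q = some t ∧
    s.1 d = t.1 d.opp ∧ 0 < (s.1 d).2

theorem bondStrength_pos_iff (α : Config T) (p q : Pos) :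
    0 < bondStrength α p q ↔ Bond α p q := by
  unfold bondStrength Bond
  rw [Finset.sum_pos_iff]
  constructor
  · rintro ⟨d, -, h⟩
    split_ifs at h with hq
    rcases hp : α p with _ | s
    · simp [hp] at h
    rcases hq' : α q with _ | t
    · simp [hq'] at h
    simp only [hp, hq', abutStrength] at h
    split_ifs at h with hst
    · exact ⟨d, s, t, hq, rfl, rfl, hst, h⟩
    · simp at h
    · simp at h
  · rintro ⟨d, s, t, hq, hp, hq', hst, h⟩
    refine ⟨d, Finset.mem_univ _, ?_⟩
    simp only [hp, hq', abutStrength, if_pos hst, if_pos hq]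
    exact h

theorem Bond.left_mem {α : Config T} {p q : Pos} (h : Bond α p q) : p ∈ dom α := by
  obtain ⟨d, s, t, -, hp, -⟩ := h
  exact ⟨s, hp⟩

theorem Bond.right_mem {α : Config T} {p q : Pos} (h : Bond α p q) : q ∈ dom α := by
  obtain ⟨d, s, t, -, -, hq, -⟩ := h
  exact ⟨t, hq⟩

theorem Bond.mono {α β : Config T} (hαβ : SubConfig α β) {p q : Pos} (h : Bond α p q) :
    Bond β p q := by
  obtain ⟨d, s, t, hd, hp, hq, h⟩ := h
  exact ⟨d, s, t, hd, (hαβ.2 p ⟨s, hp⟩) ▸ hp, (hαβ.2 q ⟨t, hq⟩) ▸ hq, h⟩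

theorem Bond.symm {α : Config T} {p q : Pos} (h : Bond α p q) : Bond α q p := by
  rw [← bondStrength_pos_iff, bondStrength_symm, bondStrength_pos_iff]
  exact h

theorem SubConfig.refl (α : Config T) : SubConfig α α := ⟨subset_rfl, fun _ _ => rfl⟩

theorem SubConfig.trans {α β γ : Config T} (h : SubConfig α β) (h' : SubConfig β γ) :
    SubConfig α γ :=
  ⟨h.1.trans h'.1, fun p hp => (h.2 p hp).trans (h'.2 p (h.1 hp))⟩

/-- Every occupied position is joined to the occupied position `r` by a chain of bonds. -/
def BondedFrom (α : Config T) (r : Pos) : Prop :=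
  r ∈ dom α ∧ ∀ p ∈ dom α, Relation.ReflTransGen (Bond α) r p

theorem bindingGraph_connected_of_bondedFrom {α : Config T} {r : Pos} (h : BondedFrom α r) :
    (bindingGraph α).Connected := by
  have key : ∀ p, Relation.ReflTransGen (Bond α) r p → ∀ hp : p ∈ dom α,
      (bindingGraph α).Reachable ⟨r, h.1⟩ ⟨p, hp⟩ := by
    intro p hp
    induction hp with
    | refl => intro _; exact SimpleGraph.Reachable.refl _
    | tail _ hbc ih =>
      intro hc
      refine (ih hbc.left_mem).trans (SimpleGraph.Adj.reachable ?_)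
      exact (bondStrength_pos_iff _ _ _).2 hbc
  have : Nonempty (dom α) := ⟨⟨r, h.1⟩⟩
  refine SimpleGraph.Connected.mk fun p q => ?_
  exact (key p (h.2 p p.2) p.2).symm.trans (key q (h.2 q q.2) q.2)

theorem bondedFrom_of_bindingGraph_connected {α : Config T} (h : (bindingGraph α).Connected)
    {r : Pos} (hr : r ∈ dom α) : BondedFrom α r := by
  refine ⟨hr, fun p hp => ?_⟩
  obtain ⟨w⟩ := h.preconnected ⟨r, hr⟩ ⟨p, hp⟩
  suffices ∀ (a b : dom α), (bindingGraph α).Walk a b →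
      Relation.ReflTransGen (Bond α) a b from this _ _ w
  intro a b w
  induction w with
  | nil => exact Relation.ReflTransGen.refl
  | cons hadj _ ih => exact Relation.ReflTransGen.head ((bondStrength_pos_iff _ _ _).1 hadj) ih

/-- A connected binding graph has no empty cut-set, and each edge weighs at least 1. -/
theorem isStable_one_of_bondedFrom {α : Config T} {r : Pos} (h : BondedFrom α r) :
    IsStable 1 α := by
  have hc := bindingGraph_connected_of_bondedFrom h
  refine ⟨hc.mono ?_, ?_⟩
  · intro p q hpq
    obtain ⟨d, s, t, hd, -⟩ := (bondStrength_pos_iff _ _ _).1 hpq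
    exact ⟨d, hd⟩
  · rintro S ⟨hS, hcut⟩
    have hne : S.Nonempty := by
      rw [Set.nonempty_iff_ne_empty]
      rintro rfl
      exact hcut (by simpa using hc.preconnected)
    obtain ⟨e, he⟩ := hne
    refine le_trans ?_ (ENNReal.le_tsum (⟨e, he⟩ : S))
    have hpos : 0 < edgeStrength α e := by
      have := hS he
      induction e with
      | _ p q => exact this
    exact_mod_cast hpos

/-- Were the graph disconnected, the empty set would be a cut-set of weight 0. -/
theorem bindingGraph_connected_of_isStable_one {α : Config T} (h : IsStable 1 α) :
    (bindingGraph α).Connected := by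
  have : Nonempty (dom α) := h.1.nonempty
  refine SimpleGraph.Connected.mk ?_
  by_contra hc
  have := h.2 ∅ ⟨Set.empty_subset _, by simpa using hc⟩
  simp at this

theorem exists_bondedFrom_of_isStable_one {α : Config T} (h : IsStable 1 α) :
    ∃ r, BondedFrom α r := by
  obtain ⟨r⟩ := h.1.nonempty
  exact ⟨r, bondedFrom_of_bindingGraph_connected (bindingGraph_connected_of_isStable_one h) r.2⟩

/-! ### Attaching single tiles -/

/-- `β` arises from `α` by placing one tile at an empty position where it binds. -/
def Attach (α β : Config T) : Prop :=
  ∃ (p : Pos) (d : Side) (s t : T), α p = some s ∧ α (p + d.vec) = none ∧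
    s.1 d = t.1 d.opp ∧ 0 < (s.1 d).2 ∧ β = Function.update α (p + d.vec) (some t)

theorem dom_update (α : Config T) (p : Pos) (t : T) :
    dom (Function.update α p (some t)) = insert p (dom α) := by
  ext q
  by_cases h : q = p
  · subst h; simp [dom]
  · simp [dom, h]

theorem notMem_dom {α : Config T} {p : Pos} : p ∉ dom α ↔ α p = none := by
  simp [dom, Option.eq_none_iff_forall_ne_some]

theorem subConfig_update {α : Config T} {p : Pos} (hp : α p = none) (t : T) :
    SubConfig α (Function.update α p (some t)) := by
  refine ⟨by rw [dom_update]; exact Set.subset_insert _ _, fun q hq => ?_⟩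
  rw [Function.update_of_ne]
  rintro rfl
  exact notMem_dom.2 hp hq

theorem Attach.subConfig {α β : Config T} (h : Attach α β) : SubConfig α β := by
  obtain ⟨p, d, s, t, -, hn, -, -, rfl⟩ := h
  exact subConfig_update hn t

theorem Attach.dom_diff {α β : Config T} (h : Attach α β) :
    ∃ p, p ∉ dom α ∧ dom β = insert p (dom α) := by
  obtain ⟨p, d, s, t, -, hn, -, -, rfl⟩ := h
  exact ⟨_, notMem_dom.2 hn, dom_update _ _ _⟩

theorem BondedFrom.attach {α β : Config T} {r : Pos} (hα : BondedFrom α r) (h : Attach α β) :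
    BondedFrom β r := by
  have hsub := h.subConfig
  obtain ⟨p, d, s, t, hp, hn, hg, hpos, rfl⟩ := h
  have old : ∀ q ∈ dom α, Relation.ReflTransGen (Bond (Function.update α (p + d.vec) (some t))) r q :=
    fun q hq => (hα.2 q hq).lift id fun _ _ => Bond.mono hsub
  refine ⟨hsub.1 hα.1, fun q hq => ?_⟩
  rw [dom_update] at hq
  rcases hq with rfl | hq
  · refine (old p ⟨s, hp⟩).tail ⟨d, s, t, rfl, ?_, by simp, hg, hpos⟩
    rw [← hsub.2 p ⟨s, hp⟩, hp]
  · exact old q hq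

/-- A stable extension of a stable assembly by one tile contains a tile that can attach. -/
theorem exists_attach_of_isStable_one {α β : Config T} (hα : IsStable 1 α) (hβ : IsStable 1 β)
    (hsub : SubConfig α β) (hcard : (dom β \ dom α).ncard = 1) : ∃ γ, Attach α γ := by
  obtain ⟨r, hr⟩ := exists_bondedFrom_of_isStable_one hα
  have hrβ := bondedFrom_of_bindingGraph_connected
    (bindingGraph_connected_of_isStable_one hβ) (hsub.1 hr.1)
  obtain ⟨p, hp⟩ := Set.ncard_eq_one.1 hcard
  have hpm : p ∈ dom β \ dom α := by rw [hp]; rfl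
  -- A chain of bonds from `α` to the new tile must leave `dom α`; the first bond that does so gives
  -- the attachment.
  have key : ∀ q, Relation.ReflTransGen (Bond β) r q → q ∈ dom α ∨ ∃ γ, Attach α γ := by
    intro q hq
    induction hq with
    | refl => exact Or.inl hr.1
    | @tail b c _ hbc ih =>
      rcases ih with hb | hγ
      · by_cases hc : c ∈ dom α
        · exact Or.inl hc
        · obtain ⟨d, s, t, rfl, hs, ht, hg, hpos⟩ := hbc
          exact Or.inr ⟨_, b, d, s, t, (hsub.2 b hb).trans hs, notMem_dom.1 hc, hg, hpos, rfl⟩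
      · exact Or.inr hγ
  exact (key p (hrβ.2 p hpm.1)).resolve_left hpm.2

/-! ### Fair growth and its limit -/

/-- A greedy growth step: attach a tile at a position that comes first in a fixed enumeration of the
lattice, or do nothing if no tile can attach. -/
def GreedyStep (α β : Config T) : Prop :=
  (Attach α β ∧ ∃ p ∈ dom β \ dom α, ∀ γ, Attach α γ → ∀ q ∈ dom γ \ dom α,
    Encodable.encode p ≤ Encodable.encode q) ∨ ((¬ ∃ γ, Attach α γ) ∧ β = α)

theorem exists_greedyStep (α : Config T) : ∃ β, GreedyStep α β := by
  classical
  by_cases h : ∃ γ, Attach α γ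
  · have hne : ∃ n : ℕ, ∃ γ, Attach α γ ∧ ∃ p ∈ dom γ \ dom α, Encodable.encode p = n := by
      obtain ⟨γ, hγ⟩ := h
      obtain ⟨p, hp, hd⟩ := hγ.dom_diff
      exact ⟨_, γ, hγ, p, ⟨by rw [hd]; exact Set.mem_insert _ _, hp⟩, rfl⟩
    obtain ⟨β, hβ, p, hp, hpn⟩ := Nat.find_spec hne
    refine ⟨β, Or.inl ⟨hβ, p, hp, fun γ hγ q hq => ?_⟩⟩
    rw [hpn]
    exact Nat.find_min' hne ⟨γ, hγ, q, hq, rfl⟩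
  · exact ⟨α, Or.inr ⟨h, rfl⟩⟩

/-- The prefix up to `β` is prescribed; fairness of the tail alone makes the limit terminal. -/
theorem exists_greedy_sequence {α β : Config T} (h : Relation.ReflTransGen Attach α β) :
    ∃ (a : ℕ → Config T) (n : ℕ), a 0 = α ∧ a n = β ∧ (∀ i < n, Attach (a i) (a (i + 1))) ∧
      ∀ i ≥ n, GreedyStep (a i) (a (i + 1)) := by
  induction h using Relation.ReflTransGen.head_induction_on with
  | refl =>
    choose g hg using exists_greedyStep (T := T)
    refine ⟨fun i => g^[i] β, 0, rfl, rfl, by simp, fun i _ => ?_⟩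
    change GreedyStep (g^[i] β) (g^[i + 1] β)
    rw [Function.iterate_succ_apply']
    exact hg _
  | @head x y hxy _ ih =>
    obtain ⟨a, n, h0, hn, hatt, hgr⟩ := ih
    refine ⟨fun i => Nat.casesOn i x a, n + 1, rfl, hn, ?_, ?_⟩
    · rintro (_ | i) hi
      · change Attach x (a 0)
        rwa [h0]
      · exact hatt i (by omega)
    · rintro (_ | i) hi
      · omega
      · exact hgr i (by omega)

open Classical in
/-- The union of an increasing sequence of configurations. -/
noncomputable def limit (a : ℕ → Config T) : Config T := fun p =>
  if h : ∃ i, p ∈ dom (a i) then a h.choose p else none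

theorem subConfig_of_le {a : ℕ → Config T} (ha : ∀ i, SubConfig (a i) (a (i + 1))) {i j : ℕ}
    (hij : i ≤ j) : SubConfig (a i) (a j) := by
  induction hij with
  | refl => exact SubConfig.refl _
  | step _ ih => exact ih.trans (ha _)

theorem subConfig_limit {a : ℕ → Config T} (ha : ∀ i, SubConfig (a i) (a (i + 1))) (i : ℕ) :
    SubConfig (a i) (limit a) := by
  have mono : ∀ i j, i ≤ j → SubConfig (a i) (a j) := fun _ _ => subConfig_of_le ha
  have key : ∀ p ∈ dom (a i), a i p = limit a p := by
    intro p hp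
    have h : ∃ i, p ∈ dom (a i) := ⟨i, hp⟩
    simp only [limit, dif_pos h]
    rcases le_total i h.choose with hle | hle
    · exact (mono _ _ hle).2 p hp
    · exact ((mono _ _ hle).2 p h.choose_spec).symm
  refine ⟨fun p hp => ?_, key⟩
  obtain ⟨t, ht⟩ := hp
  exact ⟨t, by rw [← key p ⟨t, ht⟩, ht]⟩

theorem mem_dom_limit {a : ℕ → Config T} {p : Pos} (hp : p ∈ dom (limit a)) :
    ∃ i, p ∈ dom (a i) := by
  by_contra h
  obtain ⟨t, ht⟩ := hp
  simp [limit, dif_neg h] at ht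

/-- A greedy growth process is fair: no tile can attach to its union. -/
theorem not_attach_limit {a : ℕ → Config T} (ha : ∀ i, SubConfig (a i) (a (i + 1))) {n : ℕ}
    (hgr : ∀ i ≥ n, GreedyStep (a i) (a (i + 1))) : ¬ ∃ δ, Attach (limit a) δ := by
  rintro ⟨δ, p, d, s, t, hp, hnone, hg, hpos, -⟩
  have mono : ∀ i j, i ≤ j → SubConfig (a i) (a j) := fun _ _ => subConfig_of_le ha
  obtain ⟨i₀, hi₀⟩ := mem_dom_limit ⟨s, hp⟩
  -- An attachment possible in the limit is possible at every stage from `i₀` on, since its position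
  -- is never filled.
  have hatt : ∀ j ≥ i₀, Attach (a j) (Function.update (a j) (p + d.vec) (some t)) := by
    intro j hj
    refine ⟨p, d, s, t, ?_, ?_, hg, hpos, rfl⟩
    · rw [(subConfig_limit ha j).2 p ((mono _ _ hj).1 hi₀), hp]
    · rw [← notMem_dom] at hnone ⊢
      exact fun h => hnone ((subConfig_limit ha j).1 h)
  -- Each later stage must then fill a new position encoded no higher than `p + d.vec`, and there
  -- are only finitely many of these.
  have hstep : ∀ j, ∃ q ∈ dom (a (n + i₀ + j + 1)) \ dom (a (n + i₀ + j)),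
      Encodable.encode q ≤ Encodable.encode (p + d.vec) := by
    intro j
    have hat := hatt (n + i₀ + j) (by omega)
    rcases hgr (n + i₀ + j) (by omega) with ⟨-, q, hq, hmin⟩ | ⟨hno, -⟩
    · refine ⟨q, hq, hmin _ hat _ ⟨?_, ?_⟩⟩
      · rw [dom_update]; exact Set.mem_insert _ _
      · exact fun h => notMem_dom.2 hnone ((subConfig_limit ha _).1 h)
    · exact absurd ⟨_, hat⟩ hno
  choose q hq hle using hstep
  have hinj : Function.Injective fun j => Encodable.encode (q j) := by
    have hne : ∀ i j, i < j → q i ≠ q j := fun i j hij h =>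
      (hq j).2 ((mono (n + i₀ + i + 1) (n + i₀ + j) (by omega)).1 (h ▸ (hq i).1))
    intro i j hij
    have h := Encodable.encode_injective hij
    rcases lt_trichotomy i j with hlt | heq | hlt
    · exact absurd h (hne _ _ hlt)
    · exact heq
    · exact absurd h.symm (hne _ _ hlt)
  refine Set.infinite_range_of_injective hinj ((Set.finite_Iic (Encodable.encode (p + d.vec))).subset ?_)
  rintro _ ⟨j, rfl⟩
  exact hle j

theorem BondedFrom.limit {a : ℕ → Config T} (ha : ∀ i, SubConfig (a i) (a (i + 1))) {r : Pos}
    (hb : ∀ i, BondedFrom (a i) r) : BondedFrom (limit a) r := by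
  refine ⟨(subConfig_limit ha 0).1 (hb 0).1, fun p hp => ?_⟩
  obtain ⟨i, hi⟩ := mem_dom_limit hp
  exact ((hb i).2 p hi).lift id fun _ _ => Bond.mono (subConfig_limit ha i)

/-- `Produces` ties the length of the sequence to the number of new tiles, so that number has to be
computed. -/
theorem encard_dom_diff {a : ℕ → Config T} {m : ℕ} (h : ∀ i < m, Attach (a i) (a (i + 1))) :
    dom (a 0) ⊆ dom (a m) ∧ (dom (a m) \ dom (a 0)).encard = m := by
  induction m with
  | zero => simp
  | succ m ih =>
    obtain ⟨hsub, hcard⟩ := ih fun i hi => h i (by omega)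
    obtain ⟨p, hp, hd⟩ := (h m (by omega)).dom_diff
    refine ⟨hsub.trans (h m (by omega)).subConfig.1, ?_⟩
    rw [hd, Set.insert_sdiff_of_notMem _ (fun h0 => hp (hsub h0)),
      Set.encard_insert_of_notMem (fun h0 => hp h0.1), hcard]
    push_cast
    rfl

/-! ### Directedness -/

namespace TAS

variable {𝒯 : TAS A}

theorem step_of_attach (h1 : 𝒯.temp = 1) {α β : Config 𝒯.tiles} {r : Pos}
    (hα : BondedFrom α r) (h : Attach α β) : 𝒯.Step α β := by
  obtain ⟨p, hp, hd⟩ := h.dom_diff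
  refine ⟨h1 ▸ isStable_one_of_bondedFrom hα, h1 ▸ isStable_one_of_bondedFrom (hα.attach h),
    h.subConfig, Set.ncard_eq_one.2 ⟨p, ?_⟩⟩
  rw [hd, Set.insert_sdiff_of_notMem _ hp]
  simp

theorem isTerminal_of_not_attach (h1 : 𝒯.temp = 1) {α : Config 𝒯.tiles} {r : Pos}
    (hα : BondedFrom α r) (h : ¬ ∃ β, Attach α β) : 𝒯.IsTerminal α := by
  refine ⟨h1 ▸ isStable_one_of_bondedFrom hα, Set.eq_empty_iff_forall_notMem.2 ?_⟩
  rintro p ⟨β, ⟨hs, hs', hsub, hcard⟩, -⟩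
  rw [h1] at hs hs'
  exact h (exists_attach_of_isStable_one hs hs' hsub hcard)

theorem exists_seed_bondedFrom (h1 : 𝒯.temp = 1) :
    ∃ r, BondedFrom 𝒯.seed r ∧ dom 𝒯.seed = {r} := by
  obtain ⟨r, hr⟩ := exists_bondedFrom_of_isStable_one (h1 ▸ 𝒯.seed_stable)
  obtain ⟨p, hp⟩ := Set.ncard_eq_one.1 𝒯.seed_card
  have : r = p := by simpa [hp] using hr.1
  exact ⟨r, hr, this ▸ hp⟩

theorem produces_of_attach {a : ℕ → Config 𝒯.tiles} {r : Pos} (h1 : 𝒯.temp = 1)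
    (hb : ∀ i, BondedFrom (a i) r) {γ : Config 𝒯.tiles} {k : ℕ∞}
    (hk : k = (dom γ \ dom (a 0)).encard + 1)
    (hatt : ∀ i : ℕ, ((i + 1 : ℕ) : ℕ∞) < k → Attach (a i) (a (i + 1)))
    (hdom : dom γ ⊆ ⋃ i : ℕ, ⋃ _ : (i : ℕ∞) < k, dom (a i))
    (hsub : ∀ i, SubConfig (a i) γ) : 𝒯.Produces (a 0) γ := by
  refine ⟨k, hk, a, ⟨fun i _ => (isStable_one_of_bondedFrom (hb i)).1,
    fun i hi => step_of_attach h1 (hb i) (hatt i hi)⟩, rfl, hdom.antisymm ?_, fun i _ => hsub i⟩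
  simp only [Set.iUnion_subset_iff]
  exact fun i _ => (hsub i).1

/-- At temperature 1, whatever grows from the seed extends to a producible terminal assembly. -/
theorem exists_terminal_extension (h1 : 𝒯.temp = 1) {β : Config 𝒯.tiles}
    (hβ : Relation.ReflTransGen Attach 𝒯.seed β) :
    ∃ γ ∈ 𝒯.terminalAssemblies, SubConfig β γ := by
  obtain ⟨r, hr, -⟩ := exists_seed_bondedFrom h1
  obtain ⟨a, n, h0, hn, hatt, hgr⟩ := exists_greedy_sequence hβ
  have hstep : ∀ i, Attach (a i) (a (i + 1)) ∨ ((¬ ∃ γ, Attach (a i) γ) ∧ a (i + 1) = a i) := by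
    intro i
    rcases lt_or_ge i n with hi | hi
    · exact Or.inl (hatt i hi)
    · exact (hgr i hi).imp_left And.left
  have hsub : ∀ i, SubConfig (a i) (a (i + 1)) := by
    intro i
    rcases hstep i with h | ⟨-, h⟩
    · exact h.subConfig
    · rw [h]; exact SubConfig.refl _
  have hb : ∀ i, BondedFrom (a i) r := by
    intro i
    induction i with
    | zero => rwa [h0]
    | succ i ih =>
      rcases hstep i with h | ⟨-, h⟩
      · exact ih.attach h
      · rwa [h]
  refine ⟨limit a, ⟨?_, isTerminal_of_not_attach h1 (BondedFrom.limit hsub hb)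
    (not_attach_limit hsub hgr)⟩, hn ▸ subConfig_limit hsub n⟩
  change 𝒯.Produces 𝒯.seed (limit a)
  rw [← h0]
  classical
  -- Growth that gets stuck is constant from its first stuck stage `m`, giving `m + 1` assemblies;
  -- otherwise the sequence is infinite.
  by_cases hstuck : ∃ m, ¬ ∃ γ, Attach (a m) γ
  · set m := Nat.find hstuck with hm
    have hlt : ∀ i < m, Attach (a i) (a (i + 1)) := fun i hi =>
      (hstep i).resolve_right fun h => Nat.find_min hstuck hi h.1
    have hconst : ∀ j, a (m + j) = a m := by
      intro j
      induction j with
      | zero => rfl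
      | succ j ih =>
        rcases hstep (m + j) with h | ⟨-, h⟩
        · rw [ih] at h
          exact absurd ⟨_, h⟩ (Nat.find_spec hstuck)
        · exact h.trans ih
    have hdom : dom (limit a) ⊆ dom (a m) := by
      intro p hp
      obtain ⟨i, hi⟩ := mem_dom_limit hp
      rw [← hconst i]
      exact (subConfig_of_le hsub (Nat.le_add_left i m)).1 hi
    have hcard := (encard_dom_diff hlt).2
    rw [(subConfig_limit hsub m).1.antisymm hdom] at hcard
    refine produces_of_attach (k := m + 1) h1 hb (by rw [hcard]) ?_ ?_ (subConfig_limit hsub)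
    · intro i hi
      exact hlt i (by have : i + 1 < m + 1 := by exact_mod_cast hi
                      omega)
    · refine hdom.trans (Set.subset_iUnion₂_of_subset m ?_ subset_rfl)
      exact_mod_cast Nat.lt_succ_self m
  · push Not at hstuck
    have hall : ∀ i, Attach (a i) (a (i + 1)) := fun i =>
      (hstep i).resolve_right fun h => h.1 (hstuck i)
    have hcard : (dom (limit a) \ dom (a 0)).encard = ⊤ := by
      refine ENat.eq_top_iff_forall_ge.2 fun m => ?_
      rw [← (encard_dom_diff fun i _ => hall i).2]
      exact Set.encard_le_encard (Set.sdiff_subset_sdiff_left (subConfig_limit hsub m).1)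
    refine produces_of_attach (k := ⊤) h1 hb (by rw [hcard]; rfl) (fun i _ => hall i) ?_
      (subConfig_limit hsub)
    intro p hp
    obtain ⟨i, hi⟩ := mem_dom_limit hp
    exact Set.mem_iUnion₂.2 ⟨i, ENat.natCast_lt_top i, hi⟩

/-- The form in which directedness is used: no growth from the seed can disagree with `α`. -/
theorem subConfig_of_terminalAssemblies_eq (h1 : 𝒯.temp = 1) {α : Config 𝒯.tiles}
    (hα : 𝒯.terminalAssemblies = {α}) {β : Config 𝒯.tiles}
    (hβ : Relation.ReflTransGen Attach 𝒯.seed β) : SubConfig β α := by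
  obtain ⟨γ, hγ, hsub⟩ := exists_terminal_extension h1 hβ
  rw [hα] at hγ
  exact hγ ▸ hsub

end TAS

/-! ### Simple paths and window crossings -/

/-- A simple path of `n` bonds in the binding graph of `α`. -/
structure IsBondPath {T : Finset (TileType A)} (α : Config T) (f : ℕ → Pos) (n : ℕ) : Prop where
  bond : ∀ i < n, Bond α (f i) (f (i + 1))
  injOn : Set.InjOn f {i | i ≤ n}

theorem exists_isBondPath {T : Finset (TileType A)} {α : Config T} (hα : IsStable 1 α) {p q : Pos}
    (hp : p ∈ dom α) (hq : q ∈ dom α) :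
    ∃ f n, IsBondPath α f n ∧ f 0 = p ∧ f n = q := by
  obtain ⟨w, hw⟩ := (bindingGraph_connected_of_isStable_one hα).exists_isPath ⟨p, hp⟩ ⟨q, hq⟩
  refine ⟨fun i => (w.getVert i : Pos), w.length, ⟨fun i hi => ?_, ?_⟩, by simp, by simp⟩
  · exact (bondStrength_pos_iff _ _ _).1 (w.adj_getVert_succ hi)
  · exact fun i hi j hj hij => hw.getVert_injOn hi hj (Subtype.ext hij)

theorem IsBondPath.mem_dom {T : Finset (TileType A)} {α : Config T} {f : ℕ → Pos} {n : ℕ}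
    (h : IsBondPath α f n) (h0 : f 0 ∈ dom α) {i : ℕ} (hi : i ≤ n) : f i ∈ dom α := by
  rcases i with _ | i
  · exact h0
  · exact (h.bond i hi).right_mem

/-- The columns of the lattice counted in the direction `e = ±1`. -/
def col (e : ℤ) (p : Pos) : ℤ := e * p.1

/-- The indices at which the path `f` crosses the window after column `c` outwards. -/
def outIdx (e : ℤ) (f : ℕ → Pos) (n : ℕ) (c : ℤ) : Finset ℕ :=
  (Finset.range n).filter fun i => col e (f i) ≤ c ∧ c < col e (f (i + 1))

/-- The indices at which the path `f` crosses the window after column `c` inwards. -/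
def inIdx (e : ℤ) (f : ℕ → Pos) (n : ℕ) (c : ℤ) : Finset ℕ :=
  (Finset.range n).filter fun i => c < col e (f i) ∧ col e (f (i + 1)) ≤ c

/-- The cells at which the path `f` crosses the window after column `c` outwards. -/
def outCells (e : ℤ) (f : ℕ → Pos) (n : ℕ) (c : ℤ) : Finset (ℤ × ℤ) :=
  (outIdx e f n c).image fun i => (f i).2

/-- The cells at which the path `f` crosses the window after column `c` inwards. -/
def inCells (e : ℤ) (f : ℕ → Pos) (n : ℕ) (c : ℤ) : Finset (ℤ × ℤ) :=
  (inIdx e f n c).image fun i => (f i).2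

theorem mem_outIdx {e : ℤ} {f : ℕ → Pos} {n : ℕ} {c : ℤ} {i : ℕ} :
    i ∈ outIdx e f n c ↔ i < n ∧ col e (f i) ≤ c ∧ c < col e (f (i + 1)) := by
  simp [outIdx]

theorem mem_inIdx {e : ℤ} {f : ℕ → Pos} {n : ℕ} {c : ℤ} {i : ℕ} :
    i ∈ inIdx e f n c ↔ i < n ∧ c < col e (f i) ∧ col e (f (i + 1)) ≤ c := by
  simp [inIdx]

/-- Crossings alternate, beginning with an outward one since the path starts inside. -/
theorem card_outIdx (e : ℤ) (f : ℕ → Pos) (n : ℕ) (c : ℤ) (h0 : col e (f 0) ≤ c) :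
    (outIdx e f n c).card = (inIdx e f n c).card + if c < col e (f n) then 1 else 0 := by
  unfold outIdx inIdx
  induction n with
  | zero => simp [not_lt.2 h0]
  | succ n ih =>
    rw [Finset.range_add_one, Finset.filter_insert, Finset.filter_insert]
    split_ifs at ih ⊢ <;>
      first
        | omega
        | (simp only [Finset.card_insert_of_notMem, Finset.mem_filter, Finset.mem_range, lt_irrefl,
            false_and, not_false_eq_true]
           omega)

/-- `D` is the side of a cube that faces in the direction `e = ±1` of the first axis. -/
structure IsDirection (D : Side) (e : ℤ) : Prop where
  mul_self : e * e = 1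
  vec_eq : D.vec = (e, 0, 0)

theorem isDirection_east : IsDirection Side.east 1 := ⟨rfl, rfl⟩

theorem isDirection_west : IsDirection Side.west (-1) := ⟨rfl, rfl⟩

theorem IsDirection.ext {D : Side} {e : ℤ} (h : IsDirection D e) {p q : Pos}
    (hc : col e p = col e q) (h2 : p.2 = q.2) : p = q := by
  refine Prod.ext ?_ h2
  have : e * (e * p.1) = e * (e * q.1) := congrArg (e * ·) hc
  rwa [← mul_assoc, ← mul_assoc, h.mul_self, one_mul, one_mul] at this

theorem IsDirection.eq_or {D : Side} {e : ℤ} (h : IsDirection D e) :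
    (D = .east ∧ e = 1) ∨ (D = .west ∧ e = -1) := by
  have := h.vec_eq
  have hm := h.mul_self
  cases D <;> simp [Side.vec, Prod.ext_iff] at this <;> subst this <;> simp_all

theorem IsDirection.crossing {D : Side} {e : ℤ} (h : IsDirection D e) {p : Pos} {d : Side} {c : ℤ}
    (hp : col e p ≤ c) (hq : c < col e (p + d.vec)) : d = D ∧ col e p = c := by
  rcases h.eq_or with ⟨rfl, rfl⟩ | ⟨rfl, rfl⟩ <;> cases d <;> simp [col, Side.vec] at * <;> omega

theorem IsDirection.crossing_bond {T : Finset (TileType A)} {α : Config T} {D : Side} {e : ℤ}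
    (h : IsDirection D e) {p q : Pos} {c : ℤ} (hb : Bond α p q) (hp : col e p ≤ c)
    (hq : c < col e q) : col e p = c ∧ col e q = c + 1 ∧ q.2 = p.2 ∧ q = p + D.vec := by
  obtain ⟨d, s, t, rfl, -⟩ := hb
  obtain ⟨rfl, hc⟩ := h.crossing hp hq
  refine ⟨hc, ?_, ?_, rfl⟩
  · rw [← hc, col, h.vec_eq, Prod.fst_add, mul_add, h.mul_self]; rfl
  · rw [h.vec_eq]; simp [Prod.ext_iff]

section Crossings

variable {T : Finset (TileType A)} {α : Config T} {D : Side} {e : ℤ} {f : ℕ → Pos} {n : ℕ} {c : ℤ}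

/-- Every outward crossing starts in column `c` exactly, so its cell determines its position, which
a simple path visits once. -/
theorem eq_of_mem_outIdx (h : IsDirection D e) (hf : IsBondPath α f n) {i j : ℕ}
    (hi : i ∈ outIdx e f n c) (hj : j ∈ outIdx e f n c) (hij : (f i).2 = (f j).2) : i = j := by
  rw [mem_outIdx] at hi hj
  refine hf.injOn hi.1.le hj.1.le (h.ext ?_ hij)
  rw [(h.crossing_bond (hf.bond i hi.1) hi.2.1 hi.2.2).1,
    (h.crossing_bond (hf.bond j hj.1) hj.2.1 hj.2.2).1]

theorem eq_of_mem_inIdx (h : IsDirection D e) (hf : IsBondPath α f n) {i j : ℕ}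
    (hi : i ∈ inIdx e f n c) (hj : j ∈ inIdx e f n c) (hij : (f i).2 = (f j).2) : i = j := by
  rw [mem_inIdx] at hi hj
  refine hf.injOn hi.1.le hj.1.le (h.ext ?_ hij)
  rw [(h.crossing_bond (hf.bond i hi.1).symm hi.2.2 hi.2.1).2.1,
    (h.crossing_bond (hf.bond j hj.1).symm hj.2.2 hj.2.1).2.1]

/-- A shared cell would mean traversing one grid edge in both directions. -/
theorem disjoint_outCells_inCells (h : IsDirection D e) (hf : IsBondPath α f n) :
    Disjoint (outCells e f n c) (inCells e f n c) := by
  rw [Finset.disjoint_left]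
  simp only [outCells, inCells, Finset.mem_image]
  rintro _ ⟨i, hi, rfl⟩ ⟨j, hj, hij⟩
  rw [mem_outIdx] at hi
  rw [mem_inIdx] at hj
  have hi' := h.crossing_bond (hf.bond i hi.1) hi.2.1 hi.2.2
  have hj' := h.crossing_bond (hf.bond j hj.1).symm hj.2.2 hj.2.1
  have h1 : f i = f (j + 1) := h.ext (hi'.1.trans hj'.1.symm) (hij.symm.trans hj'.2.2.1)
  have h2 : f (i + 1) = f j := h.ext (hi'.2.1.trans hj'.2.1.symm) (hi'.2.2.1.trans hij.symm)
  have e1 : i = j + 1 := hf.injOn hi.1.le hj.1 h1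
  have e2 : i + 1 = j := hf.injOn hi.1 hj.1.le h2
  omega

/-- Disjointness gives out + in ≤ 2k and alternation gives out ≤ in + 1; parity yields out ≤ k. -/
theorem card_outCells_le (h : IsDirection D e) (hf : IsBondPath α f n) (h0 : col e (f 0) ≤ c)
    {C : Finset (ℤ × ℤ)} (hC : ∀ i ≤ n, (f i).2 ∈ C) {k : ℕ} (hk : C.card = 2 * k) :
    (outCells e f n c).card ≤ k := by
  have hR : (outCells e f n c).card ≤ (outIdx e f n c).card := Finset.card_image_le
  have hL : (inCells e f n c).card = (inIdx e f n c).card :=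
    Finset.card_image_of_injOn fun i hi j hj hij => eq_of_mem_inIdx h hf hi hj hij
  have hcard := card_outIdx e f n c h0
  have hunion : (outCells e f n c ∪ inCells e f n c).card ≤ C.card := by
    refine Finset.card_le_card (Finset.union_subset ?_ ?_)
    · simp only [outCells, Finset.image_subset_iff]
      exact fun i hi => hC i (mem_outIdx.1 hi).1.le
    · simp only [inCells, Finset.image_subset_iff]
      exact fun i hi => hC i (mem_inIdx.1 hi).1.le
  rw [Finset.card_union_of_disjoint (disjoint_outCells_inCells h hf)] at hunion
  split_ifs at hcard <;> omega

end Crossings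

/-! ### Glues, translations and the spliced path -/

theorem mem_glues {T : Finset (TileType A)} (t : T) (d : Side) : t.1 d ∈ glues T := by
  classical
  exact Finset.mem_biUnion.2 ⟨t.1, t.2, Finset.mem_image_of_mem _ (Finset.mem_univ _)⟩

/-- The glue that `α` shows on side `D` of position `p` (a default glue if `p` is empty). -/
def glueAt {T : Finset (TileType A)} (α : Config T) (D : Side) (p : Pos) : Glue A :=
  ((α p).map fun t => t.1 D).getD ([], 0)

theorem glueAt_eq {T : Finset (TileType A)} {α : Config T} {D : Side} {p : Pos} {t : T}
    (h : α p = some t) : glueAt α D p = t.1 D := by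
  simp [glueAt, h]

/-- Translation by `m` columns in the direction `e`. -/
def shift (e m : ℤ) (p : Pos) : Pos := p + (e * m, 0, 0)

theorem col_shift {e : ℤ} (he : e * e = 1) (m : ℤ) (p : Pos) :
    col e (shift e m p) = col e p + m := by
  simp only [col, shift, Prod.fst_add]
  rw [mul_add, ← mul_assoc, he, one_mul]

theorem shift_snd (e m : ℤ) (p : Pos) : (shift e m p).2 = p.2 := by
  simp [shift, Prod.ext_iff]

theorem shift_add (e m : ℤ) (p v : Pos) : shift e m (p + v) = shift e m p + v := by
  simp only [shift]; abel

theorem shift_injective (e m : ℤ) : Function.Injective (shift e m) := add_left_injective _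

/-- The position visited by the spliced path in a given state: `(false, i)` stands for `f i`, before
the window after column `c₂`, and `(true, j)` for the translate of `f j`, which lies beyond the window
after column `c₁`, by `c₂ - c₁` columns. -/
def splicePos (e : ℤ) (f : ℕ → Pos) (c₁ c₂ : ℤ) : Bool × ℕ → Pos
  | (false, i) => f i
  | (true, j) => shift e (c₂ - c₁) (f j)

/-- The states of the spliced path. -/
def SpliceValid (e : ℤ) (f : ℕ → Pos) (n : ℕ) (c₁ c₂ : ℤ) : Bool × ℕ → Prop
  | (false, i) => i ≤ n ∧ col e (f i) ≤ c₂
  | (true, j) => j ≤ n ∧ c₁ < col e (f j)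

/-- The transitions of the spliced path, which follows `f` before the window after column `c₂`, and the
translate of `f` beyond it. -/
inductive SpliceStep (e : ℤ) (f : ℕ → Pos) (n : ℕ) (c₁ c₂ : ℤ) : Bool × ℕ → Bool × ℕ → Prop
  | inner {i : ℕ} (hi : i < n) (h : col e (f i) ≤ c₂) (h' : col e (f (i + 1)) ≤ c₂) :
      SpliceStep e f n c₁ c₂ (false, i) (false, i + 1)
  | outward {i j : ℕ} (hi : i ∈ outIdx e f n c₂) (hj : j ∈ outIdx e f n c₁)
      (h : (f i).2 = (f j).2) : SpliceStep e f n c₁ c₂ (false, i) (true, j + 1)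
  | outer {j : ℕ} (hj : j < n) (h : c₁ < col e (f j)) (h' : c₁ < col e (f (j + 1))) :
      SpliceStep e f n c₁ c₂ (true, j) (true, j + 1)
  | inward {i j : ℕ} (hj : j ∈ inIdx e f n c₁) (hi : i ∈ inIdx e f n c₂)
      (h : (f i).2 = (f j).2) : SpliceStep e f n c₁ c₂ (true, j) (false, i + 1)

section Splice

variable {T : Finset (TileType A)} {α : Config T} {D : Side} {e : ℤ} {f : ℕ → Pos} {n : ℕ}
  {c₁ c₂ : ℤ}

theorem SpliceStep.valid {s s' : Bool × ℕ} (h : SpliceStep e f n c₁ c₂ s s') :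
    SpliceValid e f n c₁ c₂ s' := by
  cases h with
  | inner hi h h' => exact ⟨hi, h'⟩
  | outward hi hj h => rw [mem_outIdx] at hj; exact ⟨hj.1, hj.2.2⟩
  | outer hj h h' => exact ⟨hj, h'⟩
  | inward hj hi h => rw [mem_inIdx] at hi; exact ⟨hi.1, hi.2.2⟩

theorem SpliceStep.ne_start {s : Bool × ℕ} (h : SpliceStep e f n c₁ c₂ s (false, 0)) : False := by
  cases h

/-- The target state tells on which side of the window the preceding point of `f` lies, hence the
kind of step; at a switch the shared cell then fixes the source. -/
theorem SpliceStep.left_unique (hD : IsDirection D e) (hf : IsBondPath α f n)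
    {s u s' : Bool × ℕ} (h : SpliceStep e f n c₁ c₂ s s') (h' : SpliceStep e f n c₁ c₂ u s') :
    s = u := by
  cases h with
  | inner hi h1 h2 =>
    cases h' with
    | inner => rfl
    | inward hj hi' h => exact absurd (mem_inIdx.1 hi').2.1 (not_lt.2 h1)
  | outward hi hj h =>
    cases h' with
    | outward hi' hj' h' => rw [eq_of_mem_outIdx hD hf hi hi' (h.trans h'.symm)]
    | outer hj' h1 h2 => exact absurd h1 (not_lt.2 (mem_outIdx.1 hj).2.1)
  | outer hj h1 h2 =>
    cases h' with
    | outer => rfl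
    | outward hi' hj' h => exact absurd h1 (not_lt.2 (mem_outIdx.1 hj').2.1)
  | inward hj hi h =>
    cases h' with
    | inner hi' h1 h2 => exact absurd (mem_inIdx.1 hi).2.1 (not_lt.2 h1)
    | inward hj' hi' h' => rw [eq_of_mem_inIdx hD hf hj hj' (h.symm.trans h')]

/-- Equal cell sets supply a matching crossing at each switch. An inner state is never at index `n`,
as `f n` lies beyond `c₂`. -/
theorem exists_spliceStep (hend : c₂ < col e (f n))
    (hout : outCells e f n c₁ = outCells e f n c₂) (hin : inCells e f n c₁ = inCells e f n c₂)
    {s : Bool × ℕ} (hs : SpliceValid e f n c₁ c₂ s) (hne : s ≠ (true, n)) :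
    ∃ s', SpliceStep e f n c₁ c₂ s s' := by
  rcases s with ⟨_ | _, i⟩
  · obtain ⟨hi, hc⟩ := hs
    have hlt : i < n := by
      refine lt_of_le_of_ne hi ?_
      rintro rfl
      exact not_lt.2 hc hend
    rcases le_or_gt (col e (f (i + 1))) c₂ with h | h
    · exact ⟨_, .inner hlt hc h⟩
    · have hi : i ∈ outIdx e f n c₂ := mem_outIdx.2 ⟨hlt, hc, h⟩
      have hmem : (f i).2 ∈ outCells e f n c₁ := hout ▸ Finset.mem_image_of_mem _ hi
      obtain ⟨j, hj, hji⟩ := Finset.mem_image.1 hmem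
      exact ⟨_, .outward hi hj hji.symm⟩
  · obtain ⟨hi, hc⟩ := hs
    have hlt : i < n := lt_of_le_of_ne hi fun h => hne (by rw [h])
    rcases lt_or_ge c₁ (col e (f (i + 1))) with h | h
    · exact ⟨_, .outer hlt hc h⟩
    · have hi : i ∈ inIdx e f n c₁ := mem_inIdx.2 ⟨hlt, hc, h⟩
      have hmem : (f i).2 ∈ inCells e f n c₂ := hin ▸ Finset.mem_image_of_mem _ hi
      obtain ⟨j, hj, hji⟩ := Finset.mem_image.1 hmem
      exact ⟨_, .inward hi hj hji⟩

/-- The two kinds of state are separated by the window: columns at most `c₂` for `false`, greater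
than `c₂` for `true`. -/
theorem splicePos_injOn (hD : IsDirection D e) (hf : IsBondPath α f n) {s s' : Bool × ℕ}
    (hs : SpliceValid e f n c₁ c₂ s) (hs' : SpliceValid e f n c₁ c₂ s')
    (h : splicePos e f c₁ c₂ s = splicePos e f c₁ c₂ s') : s = s' := by
  rcases s with ⟨_ | _, i⟩ <;> rcases s' with ⟨_ | _, j⟩ <;> simp only [splicePos] at h <;>
    obtain ⟨hi, hci⟩ := hs <;> obtain ⟨hj, hcj⟩ := hs'
  · rw [hf.injOn hi hj h]
  · have := congrArg (col e) h
    rw [col_shift hD.mul_self] at this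
    omega
  · have := congrArg (col e) h
    rw [col_shift hD.mul_self] at this
    omega
  · rw [hf.injOn hi hj (shift_injective _ _ h)]

/-- Successive tiles of the spliced path bind. -/
theorem SpliceStep.bond (hD : IsDirection D e) (hf : IsBondPath α f n)
    (hglue : ∀ i ∈ outIdx e f n c₁, ∀ j ∈ outIdx e f n c₂, (f i).2 = (f j).2 →
      glueAt α D (f i) = glueAt α D (f j))
    {s s' : Bool × ℕ} (h : SpliceStep e f n c₁ c₂ s s')
    (hs : α (splicePos e f c₁ c₂ s) = α (f s.2)) :
    ∃ (d : Side) (u v : T), splicePos e f c₁ c₂ s' = splicePos e f c₁ c₂ s + d.vec ∧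
      α (f s.2) = some u ∧ α (f s'.2) = some v ∧ u.1 d = v.1 d.opp ∧ 0 < (u.1 d).2 := by
  cases h with
  | inner hi h1 h2 =>
    obtain ⟨d, u, v, hd, h⟩ := hf.bond _ hi
    exact ⟨d, u, v, hd, h⟩
  | outer hj h1 h2 =>
    obtain ⟨d, u, v, hd, h⟩ := hf.bond _ hj
    refine ⟨d, u, v, ?_, h⟩
    simp only [splicePos]
    rw [hd, shift_add]
  | @outward i j hi hj h =>
    have hg := hglue j hj i hi h.symm
    rw [mem_outIdx] at hi hj
    obtain ⟨d, u, v, hd, hu, hv, huv, hpos⟩ := hf.bond i hi.1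
    obtain ⟨d', u', v', hd', hu', hv', huv', hpos'⟩ := hf.bond j hj.1
    obtain ⟨rfl, hc⟩ := hD.crossing hi.2.1 (hd ▸ hi.2.2)
    obtain ⟨rfl, hc'⟩ := hD.crossing hj.2.1 (hd' ▸ hj.2.2)
    rw [glueAt_eq hu, glueAt_eq hu'] at hg
    refine ⟨d', u, v', ?_, hu, hv', hg ▸ huv', hpos⟩
    simp only [splicePos]
    rw [hd', shift_add]
    congr 1
    refine hD.ext ?_ (by rw [shift_snd, h])
    rw [col_shift hD.mul_self, hc, hc']
    ring
  -- No glue hypothesis here: `shift e (c₂ - c₁) (f j)` equals `f i`, and `hs` says that `α` has the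
  -- tile of `f j` there, so the bond of `f` after `i` applies.
  | @inward i j hj hi h =>
    rw [mem_inIdx] at hi hj
    have hci := hD.crossing_bond (hf.bond i hi.1).symm hi.2.2 hi.2.1
    have hcj := hD.crossing_bond (hf.bond j hj.1).symm hj.2.2 hj.2.1
    have heq : shift e (c₂ - c₁) (f j) = f i := by
      refine hD.ext ?_ (by rw [shift_snd, h])
      rw [col_shift hD.mul_self, hci.2.1, hcj.2.1]
      ring
    obtain ⟨d, u, v, hd, hu, hv, huv⟩ := hf.bond i hi.1
    refine ⟨d, u, v, ?_, ?_, hv, huv⟩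
    · simp only [splicePos]
      rw [heq, hd]
    · rw [← hs]
      simp only [splicePos]
      rw [heq, hu]

end Splice

/-! ### Two similar windows are impossible -/

/-- A repetition could be traced back, predecessor by predecessor, to a predecessor of the start. -/
theorem injOn_of_left_unique {S : Type*} {r : S → S → Prop} {s : ℕ → S}
    (hr : ∀ a b c, r a c → r b c → a = b) (h0 : ∀ a, ¬ r a (s 0)) {t : ℕ}
    (hs : ∀ i < t, r (s i) (s (i + 1))) : ∀ i j, i < j → j ≤ t → s i ≠ s j := by
  intro i
  induction i with
  | zero =>
    rintro (_ | j) hij hj h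
    · omega
    · exact h0 (s j) (h ▸ hs j (by omega))
  | succ i ih =>
    rintro (_ | j) hij hj h
    · omega
    · exact ih j (by omega) (by omega) (hr _ _ _ (hs i (by omega)) (h ▸ hs j (by omega)))

/-- In a directed system at temperature 1, a simple path cannot cross two windows in the same cells,
in the same directions and with the same outward glues, if it leads from the seed to a column that
no tile exceeds. -/
theorem TAS.not_similar_windows {𝒯 : TAS A} (h1 : 𝒯.temp = 1) {α : Config 𝒯.tiles}
    (hα : 𝒯.terminalAssemblies = {α}) {D : Side} {e : ℤ} (hD : IsDirection D e) {f : ℕ → Pos}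
    {n : ℕ} (hf : IsBondPath α f n) (hseed : f 0 ∈ dom 𝒯.seed)
    (hmax : ∀ p ∈ dom α, col e p ≤ col e (f n)) {c₁ c₂ : ℤ} (hc : c₁ < c₂)
    (hstart : col e (f 0) ≤ c₂) (hend : c₂ < col e (f n))
    (hout : outCells e f n c₁ = outCells e f n c₂) (hin : inCells e f n c₁ = inCells e f n c₂)
    (hglue : ∀ i ∈ outIdx e f n c₁, ∀ j ∈ outIdx e f n c₂, (f i).2 = (f j).2 →
      glueAt α D (f i) = glueAt α D (f j)) : False := by
  classical
  have sub : ∀ {β}, Relation.ReflTransGen Attach 𝒯.seed β → SubConfig β α :=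
    fun h => subConfig_of_terminalAssemblies_eq h1 hα h
  have hseedα := sub Relation.ReflTransGen.refl
  have hdom : ∀ i ≤ n, f i ∈ dom α := fun i hi => hf.mem_dom (hseedα.1 hseed) hi
  obtain ⟨r, -, hr⟩ := exists_seed_bondedFrom h1
  have hnext : ∀ s, ∃ s', (∃ u, SpliceStep e f n c₁ c₂ s u) → SpliceStep e f n c₁ c₂ s s' := by
    intro s
    by_cases h : ∃ u, SpliceStep e f n c₁ c₂ s u
    · exact h.imp fun _ hu _ => hu
    · exact ⟨s, fun h' => absurd h' h⟩
  choose next hnext using hnext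
  set s : ℕ → Bool × ℕ := fun t => next^[t] (false, 0) with hs
  have hs0 : s 0 = (false, 0) := rfl
  have hsucc : ∀ t, s (t + 1) = next (s t) := fun t => Function.iterate_succ_apply' _ _ _
  have hinj : ∀ t, (∀ i < t, SpliceStep e f n c₁ c₂ (s i) (s (i + 1))) →
      ∀ i j, i < j → j ≤ t → s i ≠ s j := fun t ht =>
    injOn_of_left_unique (fun _ _ _ h h' => h.left_unique hD hf h') (fun _ h => h.ne_start) ht
  have hvalid0 : SpliceValid e f n c₁ c₂ (s 0) := ⟨Nat.zero_le _, hstart⟩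
  -- Grow the spliced path tile by tile, the state with index `i` receiving the tile `α (f i)`.
  have key : ∀ t, (∀ i < t, SpliceStep e f n c₁ c₂ (s i) (s (i + 1))) ∧
      ∃ β, Relation.ReflTransGen Attach 𝒯.seed β ∧
        (∀ p ∈ dom β, ∃ i ≤ t, p = splicePos e f c₁ c₂ (s i)) ∧
        β (splicePos e f c₁ c₂ (s t)) = α (f (s t).2) := by
    intro t
    induction t with
    | zero =>
      refine ⟨by simp, 𝒯.seed, .refl, fun p hp => ⟨0, le_rfl, ?_⟩, hseedα.2 _ hseed⟩
      rw [hr] at hp hseed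
      exact hp.trans hseed.symm
    | succ t ih =>
      obtain ⟨hsteps, β, hβ, hdomβ, hlast⟩ := ih
      have hvalid : ∀ i ≤ t, SpliceValid e f n c₁ c₂ (s i) := by
        rintro (_ | i) hi
        · exact hvalid0
        · exact (hsteps i (by omega)).valid
      have hle : (s t).2 ≤ n := by
        have := hvalid t le_rfl
        rcases h : s t with ⟨_ | _, i⟩ <;> rw [h] at this <;> exact this.1
      obtain ⟨u, hu⟩ := hdom _ hle
      have hαt : α (splicePos e f c₁ c₂ (s t)) = α (f (s t).2) := by
        rw [← hlast]
        exact ((sub hβ).2 _ ⟨u, hlast.trans hu⟩).symm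
      -- The translated endpoint lies `c₂ - c₁ > 0` columns beyond the maximum.
      have hne : s t ≠ (true, n) := by
        intro h
        have := hmax _ ⟨u, hαt.trans hu⟩
        rw [h] at this
        simp only [splicePos, col_shift hD.mul_self] at this
        omega
      have hstep : SpliceStep e f n c₁ c₂ (s t) (s (t + 1)) := by
        rw [hsucc]
        exact hnext _ (exists_spliceStep hend hout hin (hvalid t le_rfl) hne)
      have hsteps' : ∀ i < t + 1, SpliceStep e f n c₁ c₂ (s i) (s (i + 1)) := by
        intro i hi
        rcases Nat.lt_succ_iff_lt_or_eq.1 hi with hi | rfl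
        · exact hsteps i hi
        · exact hstep
      obtain ⟨d, u, v, hd, hu, hv, huv, hpos⟩ := hstep.bond hD hf hglue hαt
      refine ⟨hsteps', _, hβ.tail ⟨splicePos e f c₁ c₂ (s t), d, u, v, hlast.trans hu, ?_, huv, hpos,
        rfl⟩, ?_, ?_⟩
      -- The next position is empty, since states do not repeat and distinct valid states have
      -- distinct positions.
      · rw [← hd, ← notMem_dom]
        intro hmem
        obtain ⟨i, hi, hpi⟩ := hdomβ _ hmem
        exact hinj _ hsteps' i (t + 1) (by omega) le_rfl
          (splicePos_injOn hD hf hstep.valid (hvalid i hi) hpi).symm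
      · intro p hp
        rw [dom_update, ← hd] at hp
        rcases hp with rfl | hp
        · exact ⟨t + 1, le_rfl, rfl⟩
        · obtain ⟨i, hi, hpi⟩ := hdomβ p hp
          exact ⟨i, by omega, hpi⟩
      · rw [← hd, Function.update_self, hv]
  have hall : ∀ i, SpliceStep e f n c₁ c₂ (s i) (s (i + 1)) := fun i =>
    (key (i + 1)).1 i (Nat.lt_succ_self i)
  have hsinj : Function.Injective fun i => s (i + 1) := by
    intro i j hij
    rcases lt_trichotomy i j with h | h | h
    · exact absurd hij (hinj (j + 1) (fun i _ => hall i) _ _ (by omega) le_rfl)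
    · exact h
    · exact absurd hij.symm (hinj (i + 1) (fun i _ => hall i) _ _ (by omega) le_rfl)
  -- The walk never stops or repeats, yet valid states have index at most `n`.
  refine Set.infinite_range_of_injective hsinj
    (((Set.finite_univ (α := Bool)).prod (Set.finite_Iic n)).subset ?_)
  rintro _ ⟨i, rfl⟩
  refine ⟨Set.mem_univ _, ?_⟩
  have := (hall i).valid
  change (s (i + 1)).2 ≤ n
  rcases h : s (i + 1) with ⟨_ | _, j⟩ <;> rw [h] at this <;> exact this.1

/-! ### Counting crossing patterns -/

/-- The number of windows between the seed and the last column is bounded by the number of possible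
crossing patterns. -/
theorem TAS.card_windows_le {𝒯 : TAS A} (h1 : 𝒯.temp = 1) {α : Config 𝒯.tiles}
    (hα : 𝒯.terminalAssemblies = {α}) {D : Side} {e : ℤ} (hD : IsDirection D e) {f : ℕ → Pos}
    {n : ℕ} (hf : IsBondPath α f n) (hseed : f 0 ∈ dom 𝒯.seed)
    (hmax : ∀ p ∈ dom α, col e p ≤ col e (f n)) {C : Finset (ℤ × ℤ)}
    (hC : ∀ i ≤ n, (f i).2 ∈ C) {k : ℕ} (hk : C.card = 2 * k) :
    (Finset.Ico (col e (f 0)) (col e (f n))).card ≤ 16 ^ k * (glues 𝒯.tiles).card ^ k := by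
  classical
  by_contra! hlt
  set W := Finset.Ico (col e (f 0)) (col e (f n)) with hW
  have hpat : ∀ c ∈ W, (outCells e f n c, inCells e f n c) ∈ C.powerset ×ˢ C.powerset := by
    intro c _
    rw [Finset.mem_product, Finset.mem_powerset, Finset.mem_powerset, outCells, inCells,
      Finset.image_subset_iff, Finset.image_subset_iff]
    exact ⟨fun i hi => hC i (mem_outIdx.1 hi).1.le, fun i hi => hC i (mem_inIdx.1 hi).1.le⟩
  -- Two subsets of `2k` cells: `2 ^ (2k) * 2 ^ (2k) = 16 ^ k`.
  have hcardpat : (C.powerset ×ˢ C.powerset).card = 16 ^ k := by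
    rw [Finset.card_product, Finset.card_powerset, hk, ← pow_add, ← two_mul, ← mul_assoc, pow_mul]
    norm_num
  -- Pigeonhole twice: first on the cell sets, then on the glues over `R` within one fibre.
  obtain ⟨⟨R, L⟩, -, hfib⟩ := Finset.exists_lt_card_fiber_of_mul_lt_card_of_maps_to hpat
    (by rw [hcardpat]; exact hlt)
  have hdom : ∀ i ≤ n, f i ∈ dom α := fun i hi => hf.mem_dom
    ((subConfig_of_terminalAssemblies_eq h1 hα .refl).1 hseed) hi
  set F := W.filter fun c => (outCells e f n c, inCells e f n c) = (R, L) with hF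
  have hFmem : ∀ c ∈ F, col e (f 0) ≤ c ∧ c < col e (f n) ∧ outCells e f n c = R ∧
      inCells e f n c = L := by
    intro c hc
    simpa [hF, hW, and_assoc] using hc
  have hglues : ∀ q ∈ dom α, glueAt α D q ∈ glues 𝒯.tiles := by
    rintro q ⟨t, ht⟩
    rw [glueAt_eq ht]
    exact mem_glues t D
  have hGpos : 1 ≤ (glues 𝒯.tiles).card := Finset.card_pos.2 ⟨_, hglues _ (hdom 0 (Nat.zero_le _))⟩
  have hpos : ∀ c, ∀ i ∈ outIdx e f n c, f i = (e * c, (f i).2) := by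
    intro c i hi
    rw [mem_outIdx] at hi
    refine hD.ext ?_ rfl
    rw [(hD.crossing_bond (hf.bond i hi.1) hi.2.1 hi.2.2).1, col, ← mul_assoc, hD.mul_self, one_mul]
  have hmaps : ∀ c ∈ F, (fun (y : ℤ × ℤ) (_ : y ∈ R) => glueAt α D (e * c, y)) ∈
      R.pi fun _ => glues 𝒯.tiles := by
    intro c hc
    rw [Finset.mem_pi]
    intro y hy
    rw [← (hFmem c hc).2.2.1] at hy
    obtain ⟨i, hi, rfl⟩ := Finset.mem_image.1 hy
    rw [← hpos c i hi]
    exact hglues _ (hdom i (mem_outIdx.1 hi).1.le)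
  have hRcard : R.card ≤ k := by
    obtain ⟨c, hc⟩ := Finset.card_pos.1 (lt_of_le_of_lt (Nat.zero_le _) hfib)
    obtain ⟨h0, -, hR, -⟩ := hFmem c hc
    exact hR ▸ card_outCells_le hD hf h0 hC hk
  have hcardpi : (R.pi fun _ => glues 𝒯.tiles).card < F.card := by
    rw [Finset.card_pi, Finset.prod_const]
    exact lt_of_le_of_lt (Nat.pow_le_pow_right hGpos hRcard) hfib
  obtain ⟨c, hc, c', hc', hne, heq⟩ := Finset.exists_ne_map_eq_of_card_lt_of_maps_to hcardpi hmaps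
  have main : ∀ c ∈ F, ∀ c' ∈ F, (fun (y : ℤ × ℤ) (_ : y ∈ R) => glueAt α D (e * c, y)) =
      (fun (y : ℤ × ℤ) (_ : y ∈ R) => glueAt α D (e * c', y)) → ¬ c < c' := by
    intro c hc c' hc' heq hlt
    obtain ⟨-, -, hR, hL⟩ := hFmem c hc
    obtain ⟨h0', hn', hR', hL'⟩ := hFmem c' hc'
    refine not_similar_windows h1 hα hD hf hseed hmax hlt h0' hn' (hR.trans hR'.symm)
      (hL.trans hL'.symm) ?_
    intro i hi j hj hij
    have hmem : (f i).2 ∈ R := hR ▸ Finset.mem_image_of_mem _ hi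
    rw [hpos c i hi, hpos c' j hj, ← hij]
    exact congrFun (congrFun heq (f i).2) hmem
  rcases lt_or_gt_of_ne hne with h | h
  · exact main c hc c' hc' heq h
  · exact main c' hc' c hc heq.symm h

/-! ### From windows to the bounds -/

theorem card_glues_le (T : Finset (TileType A)) : (glues T).card ≤ 6 * T.card := by
  classical
  have : (glues T).card ≤ T.card * 6 := by
    unfold glues
    refine Finset.card_biUnion_le_card_mul _ _ _ fun t _ => ?_
    exact Finset.card_image_le
  omega

/-- A rectangle that uniquely self-assembles at temperature 1 is not much longer than the number of
crossing patterns of its windows. -/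
theorem TAS.length_le {𝒯 : TAS A} (h1 : 𝒯.temp = 1) {k N : ℕ} (hk : 1 ≤ k) (hN : 1 ≤ N)
    {X : Set Pos} (hX : IsRectangle k N X) (h : 𝒯.UniquelySelfAssembles X) :
    N ≤ 2 * (16 ^ k * (glues 𝒯.tiles).card ^ k) + 1 := by
  obtain ⟨α, hα, hdom⟩ := h
  obtain ⟨r, -, hr⟩ := exists_seed_bondedFrom h1
  have hmem : α ∈ 𝒯.terminalAssemblies := by rw [hα]; rfl
  have hstable : IsStable 1 α := h1 ▸ hmem.2.1
  have hrα : r ∈ dom α :=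
    (subConfig_of_terminalAssemblies_eq h1 hα .refl).1 (by rw [hr]; rfl)
  have hbox : ∀ p ∈ dom α, 0 ≤ p.1 ∧ p.1 < N ∧ p.2 ∈ Finset.Ico (0 : ℤ) k ×ˢ ({0, 1} : Finset ℤ) := by
    intro p hp
    have := hX.2 (hdom ▸ hp)
    simp only [Set.mem_prod, Set.mem_Ico, Set.mem_insert_iff, Set.mem_singleton_iff] at this
    simp only [Finset.mem_product, Finset.mem_Ico, Finset.mem_insert, Finset.mem_singleton]
    exact ⟨this.1.1, this.1.2, this.2.1, this.2.2⟩
  have hcard : (Finset.Ico (0 : ℤ) k ×ˢ ({0, 1} : Finset ℤ)).card = 2 * k := by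
    rw [Finset.card_product]
    simp [mul_comm]
  have hrow : ∀ x : ℤ, 0 ≤ x → x < N → ((x, 0, 0) : Pos) ∈ dom α := by
    intro x h0 hx
    rw [hdom]
    refine hX.1 ?_
    simp only [Set.mem_prod, Set.mem_Ico, Set.mem_singleton_iff]
    exact ⟨⟨h0, hx⟩, ⟨le_rfl, by omega⟩, trivial⟩
  have bound : ∀ (D : Side) (e x : ℤ), IsDirection D e → 0 ≤ x → x < N →
      (∀ p ∈ dom α, e * p.1 ≤ e * x) →
      (e * x - e * r.1).toNat ≤ 16 ^ k * (glues 𝒯.tiles).card ^ k := by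
    intro D e x hD h0 hx hmax
    obtain ⟨f, n, hf, hf0, hfn⟩ := exists_isBondPath hstable hrα (hrow x h0 hx)
    have := card_windows_le h1 hα hD hf (by rw [hf0, hr]; rfl) (by rw [hfn]; exact hmax)
      (fun i hi => (hbox _ (hf.mem_dom (hf0 ▸ hrα) hi)).2.2) hcard
    rwa [Int.card_Ico, hf0, hfn] at this
  -- The seed may lie anywhere, so both ends are used: the two distances add up to `N - 1`.
  have hE := bound _ _ (N - 1) isDirection_east (by omega) (by omega) fun p hp => by
    have := hbox p hp; omega
  have hW := bound _ _ 0 isDirection_west le_rfl (by omega) fun p hp => by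
    have := hbox p hp; omega
  have := hbox r hrα
  omega

/-- The factor `3 * k` is absorbed by `6 ^ k`, whence `576 = 6 * 6 * 16`. -/
theorem rpow_inv_div_le {k N t : ℕ} (hk : 1 ≤ k)
    (h : N ≤ 3 * (6 * t) ^ k * k * 16 ^ k) : (N : ℝ) ^ ((1 : ℝ) / k) / 576 ≤ t := by
  have h3 : ∀ m : ℕ, 3 * m ≤ 6 ^ m := by
    intro m
    induction m with
    | zero => simp
    | succ m ih => rw [pow_succ]; have := Nat.one_le_pow m 6 (by norm_num); omega
  have hN : N ≤ (576 * t) ^ k := calc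
    N ≤ (3 * k) * ((6 * t) ^ k * 16 ^ k) := by linarith
    _ ≤ 6 ^ k * ((6 * t) ^ k * 16 ^ k) := Nat.mul_le_mul_right _ (h3 k)
    _ = (576 * t) ^ k := by rw [← mul_pow, ← mul_pow]; congr 1; ring
  have hN' : (N : ℝ) ≤ (576 * t : ℝ) ^ k := by exact_mod_cast hN
  have := Real.rpow_le_rpow (Nat.cast_nonneg N) hN' (by positivity : (0 : ℝ) ≤ 1 / k)
  rw [one_div, Real.pow_rpow_inv_natCast (by positivity) (by omega)] at this
  rw [one_div]
  linarith

end ATAM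

theorem theorem1 (A : Type*) (k N : ℕ) (hk : 1 ≤ k) (hN : 1 ≤ N)
    (X : Set ATAM.Pos) (hX : ATAM.IsRectangle k N X) :
    (∀ 𝒯 : ATAM.TAS A, 𝒯.temp = 1 → 𝒯.UniquelySelfAssembles X →
      N ≤ 3 * (ATAM.glues 𝒯.tiles).card ^ k * k * 16 ^ k ∧
        (N : ℝ) ^ ((1 : ℝ) / k) / 576 ≤ (𝒯.tiles.card : ℝ)) ∧
    ENNReal.ofReal ((N : ℝ) ^ ((1 : ℝ) / k) / 576) ≤
      ((ATAM.directedTileComplexity A 1 X : ℕ∞) : ENNReal) := by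
  have main : ∀ 𝒯 : ATAM.TAS A, 𝒯.temp = 1 → 𝒯.UniquelySelfAssembles X →
      N ≤ 3 * (ATAM.glues 𝒯.tiles).card ^ k * k * 16 ^ k ∧
        (N : ℝ) ^ ((1 : ℝ) / k) / 576 ≤ (𝒯.tiles.card : ℝ) := by
    intro 𝒯 h1 hu
    have hlen := ATAM.TAS.length_le h1 hk hN hX hu
    have hG : 1 ≤ (ATAM.glues 𝒯.tiles).card := by
      obtain ⟨r, ⟨⟨t, -⟩, -⟩, -⟩ := ATAM.TAS.exists_seed_bondedFrom h1
      exact Finset.card_pos.2 ⟨_, ATAM.mem_glues t .up⟩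
    have hpos : 1 ≤ 16 ^ k * (ATAM.glues 𝒯.tiles).card ^ k :=
      Nat.one_le_iff_ne_zero.2 (by positivity)
    have hle : N ≤ 3 * (ATAM.glues 𝒯.tiles).card ^ k * k * 16 ^ k := calc
      -- The pattern count is at least 1, which absorbs the `+ 1`.
      N ≤ 3 * (16 ^ k * (ATAM.glues 𝒯.tiles).card ^ k) := by omega
      _ ≤ 3 * (16 ^ k * (ATAM.glues 𝒯.tiles).card ^ k) * k := Nat.le_mul_of_pos_right _ hk
      _ = 3 * (ATAM.glues 𝒯.tiles).card ^ k * k * 16 ^ k := by ring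
    refine ⟨hle, ATAM.rpow_inv_div_le hk (hle.trans ?_)⟩
    gcongr
    exact ATAM.card_glues_le _
  refine ⟨main, ?_⟩
  unfold ATAM.directedTileComplexity
  set S := {n : ℕ∞ | ∃ 𝒯 : ATAM.TAS A, 𝒯.temp = 1 ∧ 𝒯.UniquelySelfAssembles X ∧
    n = (𝒯.tiles.card : ℕ∞)}
  rcases S.eq_empty_or_nonempty with hS | hS
  · simp [hS]
  · obtain ⟨𝒯, h1, hu, hn⟩ := csInf_mem hS
    rw [hn]
    refine ENNReal.ofReal_le_of_le_toReal ?_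
    simpa using (main 𝒯 h1 hu).2
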